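/- Let $N\ge 1$ be an integer and let $\Lambda=[\lambda_1,\dots,\lambda_N]$ be an arbitrary vector of real numbers (repetitions are allowed, the order is irrelevant). Write $\widehat f(\xi)=\int_{\mathbb R} f(t)e^{-i\xi t}\,dt$ (extended to $L_2(\mathbb R)$ by Plancherel). Let $\phi=Q_N=Q_N[\Lambda]$ be the TB-spline of $\Lambda$, i.e. the compactly supported exponential spline with Fourier transform $$\widehat{Q_N}(\xi)=\prod_{j=1}^N\frac{e^{-\lambda_j}-e^{-i\xi}}{i\xi-\lambda_j},\qquad \xi\in\mathbb R$$ (a factor with $\lambda_j=0$ has the value $1$ at $\xi=0$); equivalently, $Q_N$ is the convolution of the functions $e^{\lambda_j(t-1)}\mathbf 1_{[0,1)}(t)$, $j=1,\dots,N$. Let $\widetilde\Lambda=[\lambda_1,\dots,\lambda_N,-\lambda_1,\dots,-\lambda_N]$ and $$\Phi_{2N-1}[\widetilde\Lambda](x;z)=\sum_{j\in\mathbb Z}z^{j}\,Q_{2N}[\widetilde\Lambda](x-j).$$ Then $\Phi_{2N-1}[\widetilde\Lambda](N;e^{i\xi})\neq0$ for all $\xi\in\mathbb R$, and there is exactly one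 function $\widetilde\phi\in L_2(\mathbb R)$ (represented by its everywhere right-continuous version) with Fourier transform $$\widehat{\widetilde\phi}(\xi)=C_S^2\,\frac{\widehat\phi(\xi)}{\Phi_{2N-1}[\widetilde\Lambda](N;e^{i\xi})},\qquad C_S=\exp\Big(\tfrac12\sum_{j=1}^N\lambda_j\Big),$$ for almost every $\xi\in\mathbb R$ (the dual function of $\phi$). For some $\varepsilon>0$, $$\phi(t)=O\left(|t|^{-1-\varepsilon}\right),\qquad \widetilde\phi(t)=O\left(|t|^{-1-\varepsilon}\right)\qquad\text{as }t\to\pm\infty,$$ and moreover there is a constant $C$ with $|\widetilde\phi(t)(1+t^2)|\le C$ for all $t\in\mathbb R$. -/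

import Mathlib

open MeasureTheory Filter Asymptotics Set
open scoped FourierTransform Topology Convolution

noncomputable section

/-- The Fourier transform in the normalization `f̂(ξ) = ∫ f(t) e^{-iξt} dt`. -/
def hatFT (f : ℝ → ℂ) (ξ : ℝ) : ℂ :=
  ∫ t : ℝ, Complex.exp (-(Complex.I * ξ * t)) * f t

/-- The TB-spline of order one, `e^{a (t - 1)}` on `[0, 1)` and `0` elsewhere. -/
def tbSplineOne (a : ℝ) : ℝ → ℝ :=
  Set.indicator (Set.Ico 0 1) (fun t => Real.exp (a * (t - 1)))

/-- The TB-spline `Q_N[Λ]` of the vector `Λ` of order `N = Λ.length`: the convolution of the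
TB-splines of order one that belong to the entries of `Λ`. The normalization is the one fixed by
the Fourier transform in `hatFT_tbSpline` below. The empty vector gets the junk value `0`. -/
def tbSpline : List ℝ → ℝ → ℝ
  | [] => 0
  | [a] => tbSplineOne a
  | a :: b :: l => tbSplineOne a ⋆[ContinuousLinearMap.mul ℝ ℝ, volume] tbSpline (b :: l)

/-- The factor `(e^{-a} - e^{-iξ}) / (iξ - a)`, with its limit `1` at the removable
singularity `a = ξ = 0`. -/
def tbFactor (a ξ : ℝ) : ℂ :=
  if a = 0 ∧ ξ = 0 then 1
  else (Complex.exp (-(a : ℂ)) - Complex.exp (-(Complex.I * ξ))) / (Complex.I * ξ - a)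

/-- The symmetrized vector `Λ̃ = [Λ, -Λ]`. -/
def symmetrized (Λ : List ℝ) : List ℝ := Λ ++ Λ.map (fun a => -a)

/-- The Euler-Schoenberg exponential spline
`Φ_{N-1}[Λ](x; z) = ∑_{j ∈ ℤ} z ^ j * Q_N[Λ](x - j)`; the sum has finitely many nonzero terms. -/
def eulerSchoenberg (Λ : List ℝ) (x : ℝ) (z : ℂ) : ℂ :=
  ∑' j : ℤ, z ^ j * (tbSpline Λ (x - j) : ℂ)

/-- The denominator `Φ_{2N-1}[Λ̃](N; e^{iξ})` in the formula for the dual function. -/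
def dualDenom (Λ : List ℝ) (ξ : ℝ) : ℂ :=
  eulerSchoenberg (symmetrized Λ) (Λ.length : ℝ) (Complex.exp (Complex.I * ξ))

/-- The constant `C_S = exp ((λ₁ + ⋯ + λ_N) / 2)`. -/
def dualConst (Λ : List ℝ) : ℝ := Real.exp (Λ.sum / 2)

/-- The prescribed Fourier transform of the dual function,
`C_S² * Q̂_N(ξ) / Φ_{2N-1}[Λ̃](N; e^{iξ})`. -/
def dualHat (Λ : List ℝ) (ξ : ℝ) : ℂ :=
  (dualConst Λ : ℂ) ^ 2 * hatFT (fun t => (tbSpline Λ t : ℂ)) ξ / dualDenom Λ ξ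

/-- `f ∈ L²(ℝ)` has the (Plancherel) Fourier transform `g`, in the normalization of `hatFT`.
Mathlib's `𝓕 f (w)` is `f̂ (2πw)`. -/
def HasL2Hat (f : ℝ → ℂ) (g : ℝ → ℂ) : Prop :=
  ∃ hf : MemLp f 2 (volume : Measure ℝ),
    ((𝓕 (hf.toLp f) : Lp ℂ 2 (volume : Measure ℝ)) : ℝ → ℂ)
      =ᵐ[volume] fun w => g (2 * Real.pi * w)

/-- `ψ` is the dual function `φ̃` of `φ = Q_N[Λ]`: the function in `L²(ℝ)` with Fourier transform
`dualHat Λ`. As this fixes `ψ` only almost everywhere, the representative is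
normalized to be continuous from the right at every point (as `tbSpline Λ` is). -/
structure IsDualFunction (Λ : List ℝ) (ψ : ℝ → ℂ) : Prop where
  hasL2Hat : HasL2Hat ψ (dualHat Λ)
  rightCont : ∀ t, ContinuousWithinAt ψ (Set.Ici t) t

/-- `f(t) = O(|t|^{-1-ε})` as `t → ±∞`. -/
def DecaysWith {E : Type*} [Norm E] (ε : ℝ) (f : ℝ → E) : Prop :=
  f =O[atBot ⊔ atTop] fun t : ℝ => |t| ^ (-1 - ε)

theorem hatFT_eq_fourier (f : ℝ → ℂ) (ξ : ℝ) : hatFT f ξ = 𝓕 f (ξ / (2 * Real.pi)) := by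
  rw [hatFT, Real.fourier_real_eq_integral_exp_smul]
  refine integral_congr_ae (Eventually.of_forall fun t => ?_)
  have hpi : (Real.pi : ℂ) ≠ 0 := by exact_mod_cast Real.pi_ne_zero
  simp only [smul_eq_mul]
  congr 2
  push_cast
  field_simp

theorem integrable_tbSplineOne (a : ℝ) : Integrable (tbSplineOne a) := by
  rw [tbSplineOne, integrable_indicator_iff measurableSet_Ico]
  exact ((by fun_prop : Continuous fun t : ℝ => Real.exp (a * (t - 1))).integrableOn_Icc
    (a := 0) (b := 1)).mono_set Ico_subset_Icc_self

theorem integrable_tbSpline : ∀ Λ : List ℝ, Integrable (tbSpline Λ)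
  | [] => integrable_zero _ _ _
  | [a] => integrable_tbSplineOne a
  | a :: b :: l => (integrable_tbSplineOne a).integrable_convolution _ (integrable_tbSpline (b :: l))

theorem hatFT_tbSplineOne (a ξ : ℝ) :
    hatFT (fun t => (tbSplineOne a t : ℂ)) ξ = tbFactor a ξ := by
  have h1 : hatFT (fun t => (tbSplineOne a t : ℂ)) ξ =
      ∫ t in (0 : ℝ)..1, Complex.exp (-(a : ℂ)) * Complex.exp ((a - Complex.I * ξ) * t) := by
    rw [intervalIntegral.integral_of_le zero_le_one, ← integral_Ico_eq_integral_Ioc,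
      ← integral_indicator measurableSet_Ico, hatFT]
    refine integral_congr_ae (Eventually.of_forall fun t => ?_)
    by_cases ht : t ∈ Set.Ico (0 : ℝ) 1
    · simp only [tbSplineOne, Set.indicator_of_mem ht]
      push_cast
      rw [← Complex.exp_add, ← Complex.exp_add]
      congr 1
      ring
    · simp [tbSplineOne, Set.indicator_of_notMem ht]
  rw [h1, intervalIntegral.integral_const_mul, tbFactor]
  split_ifs with h
  · simp [h.1, h.2]
  · have hne : (a : ℂ) - Complex.I * ξ ≠ 0 := by
      intro h0
      have hre := congrArg Complex.re h0
      have him := congrArg Complex.im h0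
      simp at hre him
      exact h ⟨hre, him⟩
    have hne' : Complex.I * ξ - (a : ℂ) ≠ 0 := by
      rw [← neg_sub]; exact neg_ne_zero.mpr hne
    rw [integral_exp_mul_complex hne, ← mul_div_assoc, div_eq_div_iff hne hne']
    have e1 : Complex.exp ((a - Complex.I * ξ) * ((1 : ℝ) : ℂ)) =
        Complex.exp (a : ℂ) * Complex.exp (-(Complex.I * ξ)) := by
      rw [← Complex.exp_add]; congr 1; push_cast; ring
    have e2 : Complex.exp (-(a : ℂ)) * Complex.exp (a : ℂ) = 1 := by
      rw [← Complex.exp_add]; simp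
    rw [e1]
    simp only [Complex.ofReal_zero, mul_zero, Complex.exp_zero]
    linear_combination (Complex.exp (-(Complex.I * ξ)) * (Complex.I * ξ - a)) * e2

/-- The Fourier transform of the TB-spline is
`∏_j (e^{-λ_j} - e^{-iξ}) / (iξ - λ_j)`. -/
theorem hatFT_tbSpline : ∀ Λ : List ℝ, Λ ≠ [] → ∀ ξ : ℝ,
    hatFT (fun t => (tbSpline Λ t : ℂ)) ξ = (Λ.map fun a => tbFactor a ξ).prod
  | [], h, _ => absurd rfl h
  | [a], _, ξ => by simpa [tbSpline] using hatFT_tbSplineOne a ξ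
  | a :: b :: l, _, ξ => by
    have ih := hatFT_tbSpline (b :: l) (by simp) ξ
    have hc : (fun t => (tbSpline (a :: b :: l) t : ℂ)) =
        (fun t => (tbSplineOne a t : ℂ)) ⋆[ContinuousLinearMap.mul ℂ ℂ, volume]
          (fun t => (tbSpline (b :: l) t : ℂ)) := by
      funext t
      simp only [tbSpline, convolution_def, ContinuousLinearMap.mul_apply']
      rw [← integral_complex_ofReal]
      push_cast
      rfl
    have hconv := Real.fourier_mul_convolution_eq (R := ℂ)
      (f₁ := fun t => (tbSplineOne a t : ℂ)) (f₂ := fun t => (tbSpline (b :: l) t : ℂ))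
      (integrable_tbSplineOne a).ofReal (integrable_tbSpline (b :: l)).ofReal (ξ / (2 * Real.pi))
    rw [hc, hatFT_eq_fourier, hconv, ← hatFT_eq_fourier, ← hatFT_eq_fourier,
      hatFT_tbSplineOne, ih]
    simp

theorem tbSpline_cons (a b : ℝ) (l : List ℝ) (t : ℝ) :
    tbSpline (a :: b :: l) t =
      Real.exp (a * (t - 1)) * ∫ u in (t - 1)..t, Real.exp (-(a * u)) * tbSpline (b :: l) u := by
  have h1 : tbSpline (a :: b :: l) t =
      ∫ s in (0 : ℝ)..1, Real.exp (a * (s - 1)) * tbSpline (b :: l) (t - s) := by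
    rw [intervalIntegral.integral_of_le zero_le_one, ← integral_Ico_eq_integral_Ioc,
      ← integral_indicator measurableSet_Ico]
    simp only [tbSpline, convolution_def, ContinuousLinearMap.mul_apply']
    refine integral_congr_ae (Eventually.of_forall fun s => ?_)
    by_cases hs : s ∈ Set.Ico (0 : ℝ) 1
    · simp [tbSplineOne, Set.indicator_of_mem hs]
    · simp [tbSplineOne, Set.indicator_of_notMem hs]
  have h2 := intervalIntegral.integral_comp_sub_left (a := 0) (b := 1)
    (fun u => Real.exp (a * (t - 1)) * (Real.exp (-(a * u)) * tbSpline (b :: l) u)) t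
  rw [sub_zero] at h2
  rw [h1, ← intervalIntegral.integral_const_mul, ← h2]
  refine intervalIntegral.integral_congr fun s _ => ?_
  rw [← mul_assoc, ← Real.exp_add]
  congr 2
  ring

theorem intervalIntegrable_exp_mul_tbSpline (a : ℝ) (Λ : List ℝ) (x y : ℝ) :
    IntervalIntegrable (fun u => Real.exp (-(a * u)) * tbSpline Λ u) volume x y :=
  (integrable_tbSpline Λ).intervalIntegrable.continuousOn_mul
    (by fun_prop : Continuous fun u : ℝ => Real.exp (-(a * u))).continuousOn

theorem continuous_tbSpline (a b : ℝ) (l : List ℝ) : Continuous (tbSpline (a :: b :: l)) := by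
  have h : tbSpline (a :: b :: l) = fun t => Real.exp (a * (t - 1)) *
      ((∫ u in (0 : ℝ)..t, Real.exp (-(a * u)) * tbSpline (b :: l) u) -
        ∫ u in (0 : ℝ)..(t - 1), Real.exp (-(a * u)) * tbSpline (b :: l) u) := by
    funext t
    rw [tbSpline_cons, intervalIntegral.integral_interval_sub_left] <;>
      exact intervalIntegrable_exp_mul_tbSpline _ _ _ _
  have hp := intervalIntegral.continuous_primitive
    (fun x y => intervalIntegrable_exp_mul_tbSpline a (b :: l) x y) 0
  rw [h]
  exact (by fun_prop : Continuous fun t : ℝ => Real.exp (a * (t - 1))).mul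
    (hp.sub (hp.comp (by fun_prop : Continuous fun t : ℝ => t - 1)))

/-- The TB-spline vanishes outside `[0, N]`. -/
theorem tbSpline_eq_zero : ∀ (Λ : List ℝ) (t : ℝ), t ∉ Set.Icc (0 : ℝ) Λ.length →
    tbSpline Λ t = 0
  | [], _, _ => rfl
  | [a], t, ht => by
    have : t ∉ Set.Ico (0 : ℝ) 1 := fun h => ht ⟨h.1, by simpa using h.2.le⟩
    simp [tbSpline, tbSplineOne, Set.indicator_of_notMem this]
  | a :: b :: l, t, ht => by
    rw [tbSpline_cons, intervalIntegral.integral_congr_ae (g := fun _ => 0),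
      intervalIntegral.integral_zero, mul_zero]
    refine (measure_eq_zero_iff_ae_notMem.1 (measure_singleton (0 : ℝ))).mp
      ((measure_eq_zero_iff_ae_notMem.1 (measure_singleton ((b :: l).length : ℝ))).mono
        fun u hu hu0 hut => ?_)
    rw [Set.uIoc_of_le (by linarith)] at hut
    rw [tbSpline_eq_zero (b :: l) u, mul_zero]
    intro hmem
    apply ht
    have h2 : u < ((b :: l).length : ℝ) := lt_of_le_of_ne hmem.2 hu
    refine ⟨hmem.1.trans hut.2, ?_⟩
    have h1 := hut.1
    simp only [List.length_cons] at h2 ⊢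
    push_cast at h2 ⊢
    linarith

/-- The TB-spline is positive on `(0, N)`. -/
theorem tbSpline_pos : ∀ (Λ : List ℝ) (t : ℝ), t ∈ Set.Ioo (0 : ℝ) Λ.length → 0 < tbSpline Λ t
  | [], t, ht => by
    have h1 := ht.1
    have h2 := ht.2
    simp at h2
    linarith
  | [a], t, ht => by
    have : t ∈ Set.Ico (0 : ℝ) 1 := ⟨ht.1.le, by simpa using ht.2⟩
    simp [tbSpline, tbSplineOne, Set.indicator_of_mem this, Real.exp_pos]
  | a :: b :: l, t, ht => by
    have hn : (1 : ℝ) ≤ ((b :: l).length : ℝ) := by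
      simp
    have hlen : ((a :: b :: l).length : ℝ) = ((b :: l).length : ℝ) + 1 := by
      simp
    have ht1 := ht.1
    have ht2 := ht.2
    rw [hlen] at ht2
    rw [tbSpline_cons]
    refine mul_pos (Real.exp_pos _) ?_
    have hnn : ∀ᵐ u : ℝ, 0 ≤ Real.exp (-(a * u)) * tbSpline (b :: l) u := by
      refine (measure_eq_zero_iff_ae_notMem.1 (measure_singleton (0 : ℝ))).mp
        ((measure_eq_zero_iff_ae_notMem.1 (measure_singleton ((b :: l).length : ℝ))).mono
          fun u hu hu0 => mul_nonneg (Real.exp_pos _).le ?_)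
      by_cases hm : u ∈ Set.Icc (0 : ℝ) (b :: l).length
      · exact (tbSpline_pos (b :: l) u
          ⟨lt_of_le_of_ne hm.1 (Ne.symm hu0), lt_of_le_of_ne hm.2 hu⟩).le
      · exact (tbSpline_eq_zero (b :: l) u hm).ge
    have hc : max 0 (t - 1) < min t ((b :: l).length : ℝ) := by
      rw [max_lt_iff, lt_min_iff, lt_min_iff]
      refine ⟨⟨ht1, by linarith⟩, by linarith, by linarith⟩
    refine lt_of_lt_of_le (intervalIntegral.intervalIntegral_pos_of_pos_on
      (intervalIntegrable_exp_mul_tbSpline a (b :: l) _ _) (fun u hu => ?_) hc) ?_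
    · exact mul_pos (Real.exp_pos _) (tbSpline_pos (b :: l) u
        ⟨(le_max_left _ _).trans_lt hu.1, hu.2.trans_le (min_le_right _ _)⟩)
    · exact intervalIntegral.integral_mono_interval (le_max_right _ _) hc.le (min_le_left _ _)
        (ae_restrict_of_ae hnn) (intervalIntegrable_exp_mul_tbSpline a (b :: l) _ _)

end

/-! Write φ = Q_N[Λ] and z = e^{iξ}. Reflecting φ in the midpoint of its support gives Q_N[-Λ] up to
the factor C_S², so Q_{2N}[Λ̃] is a shifted autocorrelation of φ and the denominator equals C_S² ∑_j
z^j ∫ φ(t) φ(t+j) dt, a trigonometric polynomial (`dualDenom_eq_sum`).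

Periodization turns this sum into ∫₀¹ |∑_k z^k φ(x+k)|² dx. If it vanished, the inner sum would
vanish for almost every x in [0,1], hence φ̂(-η) = 0 for every η with e^{iη} = z
(`integral_exp_mul_eq_zero_of_autocorrelation`). The product formula for φ̂ excludes this for a
suitable η.

Thus C_S² / denominator is 2π-periodic and C², and its Fourier coefficients c_j are O(1/(1+j²)). The
function ∑_j c_j φ(t+j) has the prescribed transform, is right-continuous like φ, and decays like
c_j because φ has compact support. Injectivity of the Plancherel transform and right-continuity make
it the only dual function, so its bounds are those claimed. -/

/-! ### Plancherel transform and uniqueness of the dual function -/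

/-- On `L¹ ∩ L²` the Plancherel transform is given by the Fourier integral. -/
theorem fourier_toLp_ae_eq {f : ℝ → ℂ} (hf₁ : Integrable f) (hf₂ : MemLp f 2 (volume : Measure ℝ)) :
    ((𝓕 (hf₂.toLp f) : Lp ℂ 2 (volume : Measure ℝ)) : ℝ → ℂ) =ᵐ[volume] 𝓕 f := by
  have hcont : Continuous (𝓕 f) :=
    VectorFourier.fourierIntegral_continuous Real.continuous_fourierChar
      (by exact continuous_inner) hf₁
  -- Test against smooth compactly supported `g`: both transforms can be moved onto `g`, by the
  -- definition for tempered distributions on one side and by Fubini on the other.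
  refine ae_eq_of_integral_contDiff_smul_eq ?_ hcont.locallyIntegrable ?_
  · exact (Lp.memLp _).locallyIntegrable (by norm_num)
  intro g hg hgc
  have hg₁ : HasCompactSupport (Complex.ofRealCLM ∘ g) := hgc.comp_left rfl
  have hg₂ : ContDiff ℝ (⊤ : ℕ∞) (Complex.ofRealCLM ∘ g) := by fun_prop
  set s : SchwartzMap ℝ ℂ := hg₁.toSchwartzMap hg₂ with hs
  have hsg : ∀ x, s x = (g x : ℂ) := fun x => rfl
  have e1 := congrArg (fun u => u s) (Lp.fourier_toTemperedDistribution_eq (hf₂.toLp f))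
  simp only [TemperedDistribution.fourier_apply, Lp.toTemperedDistribution_apply] at e1
  have e2 : ∫ x, (𝓕 s) x • (hf₂.toLp f : ℝ → ℂ) x = ∫ x, (𝓕 s) x • f x := by
    refine integral_congr_ae ?_
    filter_upwards [hf₂.coeFn_toLp] with x hx
    rw [hx]
  have e3 : ∫ x, (𝓕 s) x • f x = ∫ x, s x • 𝓕 f x := by
    have := VectorFourier.integral_fourierIntegral_smul_eq_flip (L := innerₗ ℝ)
      (μ := (volume : Measure ℝ)) (ν := (volume : Measure ℝ)) (f := (s : ℝ → ℂ)) (g := f)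
      Real.continuous_fourierChar (by exact continuous_inner) s.integrable hf₁
    rw [flip_innerₗ] at this
    rw [SchwartzMap.fourier_coe]
    exact this
  simp only [← Complex.coe_smul, ← hsg]
  rw [← e1, e2, e3]

theorem HasL2Hat.of_integrable {f g : ℝ → ℂ} (hf₁ : Integrable f)
    (hf₂ : MemLp f 2 (volume : Measure ℝ)) (h : ∀ ξ, hatFT f ξ = g ξ) : HasL2Hat f g := by
  refine ⟨hf₂, (fourier_toLp_ae_eq hf₁ hf₂).trans (Eventually.of_forall fun w => ?_)⟩
  have hpi : 2 * Real.pi ≠ 0 := by positivity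
  simp only [← h]
  rw [hatFT_eq_fourier, mul_div_cancel_left₀ w hpi]

theorem HasL2Hat.ae_eq {f₁ f₂ g : ℝ → ℂ} (h₁ : HasL2Hat f₁ g) (h₂ : HasL2Hat f₂ g) :
    f₁ =ᵐ[volume] f₂ := by
  obtain ⟨hm₁, e₁⟩ := h₁
  obtain ⟨hm₂, e₂⟩ := h₂
  have h : 𝓕 (hm₁.toLp f₁) = 𝓕 (hm₂.toLp f₂) := Lp.ext (e₁.trans e₂.symm)
  have h' : hm₁.toLp f₁ = hm₂.toLp f₂ := (Lp.fourierTransformₗᵢ ℝ ℂ).injective h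
  exact (MemLp.toLp_eq_toLp_iff hm₁ hm₂).1 h'

/-- Right-continuous functions that agree almost everywhere are equal. -/
theorem eq_of_ae_eq_of_rightCont {f g : ℝ → ℂ} (h : f =ᵐ[volume] g)
    (hf : ∀ t, ContinuousWithinAt f (Ici t) t) (hg : ∀ t, ContinuousWithinAt g (Ici t) t) :
    f = g := by
  funext t
  have hd : Dense {x | f x = g x} := Measure.dense_of_ae h
  -- The coincidence set is dense and `Ioi t` is open, so `t` is a limit from the right of points
  -- where `f` and `g` agree.
  have hne : (𝓝[Ioi t ∩ {x | f x = g x}] t).NeBot := by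
    rw [← mem_closure_iff_nhdsWithin_neBot]
    have := hd.open_subset_closure_inter (isOpen_Ioi (a := t))
    have h2 := closure_mono this
    rw [closure_closure, closure_Ioi] at h2
    exact h2 self_mem_Ici
  have hsub : Ioi t ∩ {x | f x = g x} ⊆ Ici t := fun x hx => (mem_Ioi.1 hx.1).le
  have h1 : Tendsto f (𝓝[Ioi t ∩ {x | f x = g x}] t) (𝓝 (f t)) := (hf t).mono_left
    (nhdsWithin_mono _ hsub)
  have h2 : Tendsto g (𝓝[Ioi t ∩ {x | f x = g x}] t) (𝓝 (g t)) := (hg t).mono_left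
    (nhdsWithin_mono _ hsub)
  refine tendsto_nhds_unique h1 (h2.congr' ?_)
  filter_upwards [self_mem_nhdsWithin] with x hx
  exact hx.2.symm

theorem IsDualFunction.unique {Λ : List ℝ} {ψ₁ ψ₂ : ℝ → ℂ} (h₁ : IsDualFunction Λ ψ₁)
    (h₂ : IsDualFunction Λ ψ₂) : ψ₁ = ψ₂ :=
  eq_of_ae_eq_of_rightCont (h₁.hasL2Hat.ae_eq h₂.hasL2Hat) h₁.rightCont h₂.rightCont

/-! ### Regularity, concatenation and reflection of TB-splines -/

theorem tbSplineOne_nonneg (a t : ℝ) : 0 ≤ tbSplineOne a t :=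
  indicator_nonneg (fun _ _ => (Real.exp_pos _).le) t

theorem exists_abs_tbSpline_le : ∀ Λ : List ℝ, ∃ B, 0 ≤ B ∧ ∀ t, |tbSpline Λ t| ≤ B
  | [] => ⟨0, le_rfl, fun t => by simp [tbSpline]⟩
  | [a] => by
    refine ⟨Real.exp |a|, (Real.exp_pos _).le, fun t => ?_⟩
    rw [tbSpline, abs_of_nonneg (tbSplineOne_nonneg a t), tbSplineOne]
    refine indicator_le' (fun s hs => ?_) (fun _ _ => (Real.exp_pos _).le) t
    refine Real.exp_le_exp.2 ((le_abs_self _).trans ?_)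
    rw [abs_mul]
    refine mul_le_of_le_one_right (abs_nonneg a) ?_
    rw [abs_le]
    constructor <;> linarith [hs.1, hs.2]
  | a :: b :: l => by
    have hc : HasCompactSupport (tbSpline (a :: b :: l)) :=
      HasCompactSupport.intro isCompact_Icc fun t ht => tbSpline_eq_zero (a :: b :: l) t ht
    obtain ⟨B, hB⟩ := hc.exists_bound_of_continuous (continuous_tbSpline a b l)
    exact ⟨B, (norm_nonneg _).trans (hB 0), hB⟩

theorem rightCont_tbSpline : ∀ (Λ : List ℝ) (t : ℝ), ContinuousWithinAt (tbSpline Λ) (Ici t) t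
  | [], _ => continuousWithinAt_const
  | [a], t => by
    have hexp : Continuous fun t : ℝ => Real.exp (a * (t - 1)) := by fun_prop
    rw [tbSpline, tbSplineOne]
    by_cases ht : t ∈ Ico (0 : ℝ) 1
    · refine hexp.continuousWithinAt.congr_of_eventuallyEq ?_ (indicator_of_mem ht _)
      filter_upwards [self_mem_nhdsWithin, mem_nhdsWithin_of_mem_nhds (Iio_mem_nhds ht.2)] with s h1 h2
      exact indicator_of_mem (s := Ico (0 : ℝ) 1) ⟨ht.1.trans h1, h2⟩ _
    · refine (continuousWithinAt_const (b := (0 : ℝ))).congr_of_eventuallyEq ?_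
        (indicator_of_notMem ht _)
      rcases lt_or_ge t 0 with h0 | h0
      · filter_upwards [mem_nhdsWithin_of_mem_nhds (Iio_mem_nhds h0)] with s hs
        exact indicator_of_notMem (s := Ico (0 : ℝ) 1) (fun h => (not_lt.2 h.1) hs) _
      · filter_upwards [self_mem_nhdsWithin] with s hs
        refine indicator_of_notMem (s := Ico (0 : ℝ) 1) (fun h => ht ⟨h0, ?_⟩) _
        exact lt_of_le_of_lt hs h.2
  | a :: b :: l, _ => (continuous_tbSpline a b l).continuousWithinAt

theorem tbSpline_cons_eq_convolution (a : ℝ) {L : List ℝ} (hL : L ≠ []) :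
    tbSpline (a :: L) = tbSplineOne a ⋆[ContinuousLinearMap.mul ℝ ℝ, volume] tbSpline L := by
  cases L with
  | nil => exact absurd rfl hL
  | cons b l => rfl

/-- The TB-spline of a concatenated vector is the convolution of the TB-splines of its parts. -/
theorem tbSpline_append : ∀ (L₁ L₂ : List ℝ), L₁ ≠ [] → L₂ ≠ [] →
    tbSpline (L₁ ++ L₂) = tbSpline L₁ ⋆[ContinuousLinearMap.mul ℝ ℝ, volume] tbSpline L₂
  | [], _, h, _ => absurd rfl h
  | [a], L₂, _, h₂ => tbSpline_cons_eq_convolution a h₂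
  | a :: b :: l, L₂, _, h₂ => by
    have e : tbSpline (a :: b :: l ++ L₂) = tbSplineOne a ⋆[ContinuousLinearMap.mul ℝ ℝ, volume]
        (tbSpline (b :: l) ⋆[ContinuousLinearMap.mul ℝ ℝ, volume] tbSpline L₂) := by
      rw [← tbSpline_append (b :: l) L₂ (by simp) h₂, List.cons_append,
        tbSpline_cons_eq_convolution a (by simp)]
    have hf := integrable_tbSplineOne a
    have hg := integrable_tbSpline (b :: l)
    have hk := integrable_tbSpline L₂
    obtain ⟨B, hB0, hB⟩ := exists_abs_tbSpline_le L₂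
    rw [e]
    funext x
    refine (convolution_assoc _ _ _ _ (fun x y z => by simp [mul_assoc]) hf.1 hg.1 hk.1
      (hf.ae_convolution_exists _ hg) (hg.norm.ae_convolution_exists _ hk.norm) ?_).symm
    -- Associativity is wanted at every `x`, not only almost everywhere; the bound `B` on the last
    -- factor makes the inner convolution of absolute values bounded.
    refine BddAbove.convolutionExistsAt (s := univ) _ ?_ MeasurableSet.univ (subset_univ _)
      hf.norm.integrableOn (hg.norm.integrable_convolution _ hk.norm).1
    refine ⟨(∫ t, ‖tbSpline (b :: l) t‖) * B, ?_⟩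
    rintro _ ⟨y, -, rfl⟩
    simp only [convolution_def, ContinuousLinearMap.mul_apply']
    rw [← integral_mul_const]
    refine norm_integral_le_of_norm_le (hg.norm.mul_const B) (Eventually.of_forall fun t => ?_)
    rw [norm_mul, norm_norm, norm_norm]
    exact mul_le_mul_of_nonneg_left (hB _) (norm_nonneg _)

/-- The half-open interval `[0, 1)` is not symmetric about 1/2, so the identity fails at 0 and at 1.
-/
theorem tbSplineOne_neg_ae (a : ℝ) :
    ∀ᵐ t : ℝ, tbSplineOne (-a) t = Real.exp a * tbSplineOne a (1 - t) := by
  filter_upwards [measure_eq_zero_iff_ae_notMem.1 (measure_singleton (0 : ℝ)),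
    measure_eq_zero_iff_ae_notMem.1 (measure_singleton (1 : ℝ))] with t h0 h1
  by_cases ht : t ∈ Ico (0 : ℝ) 1
  · have ht' : 1 - t ∈ Ico (0 : ℝ) 1 :=
      ⟨by linarith [ht.2], by linarith [lt_of_le_of_ne ht.1 (Ne.symm h0)]⟩
    rw [tbSplineOne, tbSplineOne, indicator_of_mem ht, indicator_of_mem ht', ← Real.exp_add]
    congr 1
    ring
  · have ht' : 1 - t ∉ Ico (0 : ℝ) 1 := fun h =>
      ht ⟨by linarith [h.2], lt_of_le_of_ne (by linarith [h.1]) h1⟩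
    rw [tbSplineOne, tbSplineOne, indicator_of_notMem ht, indicator_of_notMem ht', mul_zero]

/-- Reflection of a TB-spline in the midpoint of its support negates its vector. -/
theorem tbSpline_map_neg_ae : ∀ Λ : List ℝ, ∀ᵐ t : ℝ,
    tbSpline (Λ.map fun a => -a) t = Real.exp Λ.sum * tbSpline Λ (Λ.length - t)
  | [] => by simp [tbSpline]
  | [a] => by simpa [tbSpline] using tbSplineOne_neg_ae a
  | a :: b :: l => by
    -- From order two on the identity holds at every `t`, since the exceptional points of the
    -- factors disappear under the integral.
    refine Eventually.of_forall fun t => ?_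
    have ih := tbSpline_map_neg_ae (b :: l)
    rw [List.map_cons, tbSpline_cons_eq_convolution _ (by simp),
      tbSpline_cons_eq_convolution a (by simp)]
    simp only [convolution_def, ContinuousLinearMap.mul_apply']
    have ih' : ∀ᵐ s : ℝ, tbSpline ((b :: l).map fun a => -a) (t - s) =
        Real.exp (b :: l).sum * tbSpline (b :: l) ((b :: l).length - (t - s)) :=
      (quasiMeasurePreserving_sub_left_of_right_invariant volume t).ae ih
    rw [← integral_const_mul, ← integral_sub_left_eq_self _ volume (1 : ℝ)]
    refine integral_congr_ae ?_
    have h1 := (quasiMeasurePreserving_sub_left_of_right_invariant volume (1 : ℝ)).ae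
      (tbSplineOne_neg_ae a)
    have h2 := (quasiMeasurePreserving_sub_left_of_right_invariant volume (1 : ℝ)).ae ih'
    filter_upwards [h1, h2] with s h1 h2
    have e1 : (1 : ℝ) - (1 - s) = s := by ring
    have e2 : ((b :: l).length : ℝ) - (t - (1 - s)) = (((b :: l).length + 1 : ℕ) : ℝ) - t - s := by
      push_cast; ring
    have e3 : (a :: b :: l).sum = a + (b :: l).sum := List.sum_cons
    have e4 : (a :: b :: l).length = (b :: l).length + 1 := rfl
    rw [h1, h2, e1, e2, e3, e4, Real.exp_add]
    ring

/-- Q[Λ̃] is the convolution of Q[Λ] with Q[-Λ]; the reflection formula turns this convolution into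
an autocorrelation. -/
theorem tbSpline_symmetrized {Λ : List ℝ} (hΛ : Λ ≠ []) (y : ℝ) :
    tbSpline (symmetrized Λ) (Λ.length - y) =
      Real.exp Λ.sum * ∫ t, tbSpline Λ t * tbSpline Λ (t + y) := by
  rw [symmetrized, tbSpline_append _ _ hΛ (by simpa using hΛ), ← integral_const_mul]
  simp only [convolution_def, ContinuousLinearMap.mul_apply']
  refine integral_congr_ae ?_
  filter_upwards [(quasiMeasurePreserving_sub_left_of_right_invariant volume
    ((Λ.length : ℝ) - y)).ae (tbSpline_map_neg_ae Λ)] with s hs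
  rw [hs]
  have e : (Λ.length : ℝ) - (Λ.length - y - s) = s + y := by ring
  rw [e]
  ring

/-! ### The denominator has no zeros -/

/-- Periodization of the integral of a function supported in `[0, N]`. -/
theorem integral_eq_intervalIntegral_sum {N : ℕ} (hN : 1 ≤ N) {G : ℝ → ℂ} (hG : Integrable G)
    (h0 : ∀ t ∉ Icc (0 : ℝ) N, G t = 0) :
    ∫ t, G t = ∫ x in (0 : ℝ)..1, ∑ n ∈ Finset.Icc (-N : ℤ) N, G (x + n) := by
  have hs := hG.hasSum_intervalIntegral_comp_add_int
  rw [intervalIntegral.integral_finsetSum (f := fun (n : ℤ) (x : ℝ) => G (x + n))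
    fun n _ => (hG.comp_add_right (n : ℝ)).intervalIntegrable, ← hs.tsum_eq]
  refine tsum_eq_sum fun n hn => ?_
  rw [← intervalIntegral.integral_zero (a := (0 : ℝ)) (b := 1) (μ := volume) (E := ℂ)]
  refine intervalIntegral.integral_congr fun x hx => ?_
  rw [uIcc_of_le zero_le_one] at hx
  refine h0 _ fun hm => hn ?_
  have hN' : (1 : ℝ) ≤ N := by exact_mod_cast hN
  rw [Finset.mem_Icc]
  constructor
  · have : ((-N : ℤ) : ℝ) ≤ n := by push_cast; linarith [hm.1, hx.2]
    exact_mod_cast this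
  · have : (n : ℝ) ≤ (N : ℤ) := by push_cast; linarith [hm.2, hx.1]
    exact_mod_cast this

/-- If the symbol `∑ j, z ^ j ∫ f(t) f(t + j) dt` of the autocorrelation of `f` vanishes at
`z = e^{iη}`, then so does the Fourier integral of `f` at `-η`. -/
theorem integral_exp_mul_eq_zero_of_autocorrelation {N : ℕ} (hN : 1 ≤ N) {f : ℝ → ℝ} {B : ℝ}
    (hf : Integrable f) (hB : ∀ t, |f t| ≤ B) (h0 : ∀ t ∉ Icc (0 : ℝ) N, f t = 0) (η : ℝ)
    (h : ∑ j ∈ Finset.Icc (-N : ℤ) N,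
      Complex.exp (Complex.I * η) ^ j * ((∫ t, f t * f (t + j) : ℝ) : ℂ) = 0) :
    ∫ t : ℝ, Complex.exp (Complex.I * η * t) * (f t : ℂ) = 0 := by
  set z : ℂ := Complex.exp (Complex.I * η) with hz
  have hz0 : z ≠ 0 := Complex.exp_ne_zero _
  have hzn : ‖z‖ = 1 := by rw [hz, mul_comm, Complex.norm_exp_ofReal_mul_I]
  have hN' : (1 : ℝ) ≤ N := by exact_mod_cast hN
  -- `Z` is a Zak transform of `f`, quasi-periodic under integer shifts. The finite sum `W` agrees
  -- with it on `[0, N]` and is plainly bounded and integrable.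
  set Z : ℝ → ℂ := fun t => ∑' k : ℤ, z ^ k * (f (t + k) : ℂ) with hZ
  set W : ℝ → ℂ := fun t => ∑ k ∈ Finset.Icc (-N : ℤ) N, z ^ k * (f (t + k) : ℂ) with hW
  have hZW : ∀ t ∈ Icc (0 : ℝ) N, Z t = W t := fun t ht => by
    refine tsum_eq_sum fun k hk => ?_
    rw [h0, Complex.ofReal_zero, mul_zero]
    refine fun hm => hk ?_
    rw [Finset.mem_Icc]
    constructor
    · have : ((-N : ℤ) : ℝ) ≤ k := by push_cast; linarith [hm.1, ht.2]
      exact_mod_cast this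
    · have : (k : ℝ) ≤ (N : ℤ) := by push_cast; linarith [hm.2, ht.1]
      exact_mod_cast this
  have hZper : ∀ (t : ℝ) (n : ℤ), Z (t + n) = z ^ (-n) * Z t := fun t n => by
    simp only [hZ]
    rw [← (Equiv.addRight n).tsum_eq (fun k : ℤ => z ^ k * (f (t + k) : ℂ)), ← tsum_mul_left]
    refine tsum_congr fun k => ?_
    rw [Equiv.coe_addRight, ← mul_assoc, ← zpow_add₀ hz0]
    congr 2
    · ring
    · push_cast; ring_nf
  have hsub : ∀ x ∈ Icc (0 : ℝ) 1, x ∈ Icc (0 : ℝ) N := fun x hx => ⟨hx.1, hx.2.trans hN'⟩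
  have hfi : ∀ n : ℤ, Integrable fun t => (f (t + n) : ℂ) :=
    fun n => (hf.comp_add_right (n : ℝ)).ofReal
  have hfZ : (fun t => (f t : ℂ) * Z t) = fun t => ∑ j ∈ Finset.Icc (-N : ℤ) N,
      z ^ j * ((f t * f (t + j) : ℝ) : ℂ) := by
    funext t
    by_cases ht : t ∈ Icc (0 : ℝ) N
    · rw [hZW t ht, hW, Finset.mul_sum]
      refine Finset.sum_congr rfl fun j _ => ?_
      push_cast
      ring
    · simp [h0 t ht]
  have hffi : ∀ n : ℤ, Integrable fun t => f t * f (t + n) := fun n =>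
    (hf.comp_add_right (n : ℝ)).bdd_mul hf.1 (Eventually.of_forall hB)
  have hFi : ∀ j ∈ Finset.Icc (-N : ℤ) N,
      Integrable fun t => z ^ j * ((f t * f (t + j) : ℝ) : ℂ) :=
    fun j _ => (hffi j).ofReal.const_mul _
  have hint : Integrable fun t => (f t : ℂ) * Z t := by
    rw [hfZ]; exact integrable_finsetSum _ hFi
  have hzero : ∫ t, (f t : ℂ) * Z t = 0 := by
    rw [hfZ, integral_finsetSum _ hFi, ← h]
    refine Finset.sum_congr rfl fun j _ => ?_
    rw [integral_const_mul, integral_complex_ofReal]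
  -- Folding `f * Z` onto `[0, 1]` gives ∑_n f(x+n) z^{-n} Z(x), which is |W(x)|² because |z| = 1
  -- and `f` is real.
  have hsq : ∫ x in (0 : ℝ)..1, Complex.normSq (W x) = 0 := by
    have hcx : ((∫ x in (0 : ℝ)..1, Complex.normSq (W x) : ℝ) : ℂ) = 0 := by
      rw [← intervalIntegral.integral_ofReal, ← hzero,
        integral_eq_intervalIntegral_sum hN hint (fun t ht => by simp [h0 t ht])]
      refine intervalIntegral.integral_congr fun x hx => ?_
      rw [uIcc_of_le zero_le_one] at hx
      simp only [hZper, hZW x (hsub x hx)]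
      rw [Complex.normSq_eq_conj_mul_self]
      conv_lhs => rw [hW]
      simp only [map_sum]
      rw [Finset.sum_mul]
      refine Finset.sum_congr rfl fun n _ => ?_
      rw [map_mul, Complex.conj_ofReal, map_zpow₀, ← Complex.inv_eq_conj hzn, inv_zpow, zpow_neg]
      ring
    exact_mod_cast hcx
  obtain ⟨M, hM⟩ : ∃ M, ∀ x, ‖W x‖ ≤ M := by
    refine ⟨∑ k ∈ Finset.Icc (-N : ℤ) N, B, fun x => norm_sum_le_of_le _ fun k _ => ?_⟩
    rw [norm_mul, norm_zpow, hzn, one_zpow, one_mul, Complex.norm_real]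
    exact hB _
  have hWi : Integrable W := integrable_finsetSum _ fun k _ => (hfi k).const_mul _
  have hsqi : Integrable fun x => Complex.normSq (W x) := by
    have : Integrable fun x => ‖W x‖ * ‖W x‖ :=
      hWi.norm.bdd_mul hWi.1.norm (Eventually.of_forall fun x => by rw [norm_norm]; exact hM x)
    refine this.congr (Eventually.of_forall fun x => ?_)
    simp only [Complex.normSq_eq_norm_sq, sq]
  have hae : ∀ᵐ x ∂volume.restrict (Ioc (0 : ℝ) 1), W x = 0 := by
    rw [intervalIntegral.integral_of_le zero_le_one, integral_eq_zero_iff_of_nonneg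
      (fun x => Complex.normSq_nonneg _) hsqi.integrableOn] at hsq
    filter_upwards [hsq] with x hx
    exact Complex.normSq_eq_zero.1 hx
  have hexp : Continuous fun t : ℝ => Complex.exp (Complex.I * η * t) := by fun_prop
  have hexpn : ∀ t : ℝ, ‖Complex.exp (Complex.I * η * t)‖ ≤ 1 := fun t => by
    have e : Complex.I * η * t = ((η * t : ℝ) : ℂ) * Complex.I := by push_cast; ring
    rw [e, Complex.norm_exp_ofReal_mul_I]
  -- The same folding applied to e^{iηt} f(t) produces e^{iηx} W(x).
  rw [integral_eq_intervalIntegral_sum (G := fun t => Complex.exp (Complex.I * η * t) * (f t : ℂ))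
    hN (hf.ofReal.bdd_mul hexp.aestronglyMeasurable (Eventually.of_forall hexpn))
    (fun t ht => by simp [h0 t ht]), intervalIntegral.integral_of_le zero_le_one]
  refine integral_eq_zero_of_ae ?_
  filter_upwards [hae] with x hx
  have e : ∑ n ∈ Finset.Icc (-N : ℤ) N,
      Complex.exp (Complex.I * η * ((x + n : ℝ) : ℂ)) * ((f (x + n) : ℝ) : ℂ) =
      Complex.exp (Complex.I * η * x) * W x := by
    rw [hW, Finset.mul_sum]
    refine Finset.sum_congr rfl fun n _ => ?_
    rw [hz, ← Complex.exp_int_mul, ← mul_assoc, ← Complex.exp_add]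
    congr 2
    push_cast
    ring
  rw [e, hx, mul_zero, Pi.zero_apply]

/-- The two terms of the numerator have moduli e^{-a} and 1, so they cancel only if a = 0 and e^{iη}
= 1. The hypothesis excludes the genuine zeros, the nonzero multiples of 2π for a = 0. -/
theorem tbFactor_ne_zero (a η : ℝ) (h : η = 0 ∨ Complex.exp (Complex.I * η) ≠ 1) :
    tbFactor a η ≠ 0 := by
  unfold tbFactor
  split_ifs with h0
  · exact one_ne_zero
  · refine div_ne_zero (fun hn => ?_) fun hd => ?_
    · have he := sub_eq_zero.1 hn
      have hnorm := congrArg norm he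
      have e1 : -(Complex.I * η) = ((-η : ℝ) : ℂ) * Complex.I := by push_cast; ring
      rw [e1, Complex.norm_exp_ofReal_mul_I, Complex.norm_exp] at hnorm
      have ha : a = 0 := by simpa using hnorm
      subst ha
      rcases h with h | h
      · exact h0 ⟨rfl, h⟩
      · rw [Complex.exp_neg (Complex.I * η)] at he
        simp only [Complex.ofReal_zero, neg_zero, Complex.exp_zero] at he
        exact h (inv_eq_one.1 he.symm)
    · have hre := congrArg Complex.re hd
      have him := congrArg Complex.im hd
      simp at hre him
      exact h0 ⟨hre, him⟩

theorem hatFT_tbSpline_ne_zero {Λ : List ℝ} (hΛ : Λ ≠ []) (η : ℝ)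
    (h : η = 0 ∨ Complex.exp (Complex.I * η) ≠ 1) :
    hatFT (fun t => (tbSpline Λ t : ℂ)) η ≠ 0 := by
  rw [hatFT_tbSpline Λ hΛ]
  refine List.prod_ne_zero fun hm => ?_
  obtain ⟨a, -, ha⟩ := List.mem_map.1 hm
  exact tbFactor_ne_zero a η h ha

/-- The denominator of the dual function is the symbol of the autocorrelation of the spline. -/
theorem dualDenom_eq_sum {Λ : List ℝ} (hΛ : Λ ≠ []) (ξ : ℝ) :
    dualDenom Λ ξ = (dualConst Λ : ℂ) ^ 2 * ∑ j ∈ Finset.Icc (-(Λ.length : ℤ)) Λ.length,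
      Complex.exp (Complex.I * ξ) ^ j * ((∫ t, tbSpline Λ t * tbSpline Λ (t + j) : ℝ) : ℂ) := by
  have hc : (dualConst Λ : ℂ) ^ 2 = (Real.exp Λ.sum : ℂ) := by
    rw [dualConst, ← Complex.ofReal_pow, ← Real.exp_nat_mul]
    congr 2
    push_cast
    ring
  rw [dualDenom, eulerSchoenberg, Finset.mul_sum]
  simp only [tbSpline_symmetrized hΛ, hc]
  rw [tsum_eq_sum (s := Finset.Icc (-(Λ.length : ℤ)) Λ.length)]
  · refine Finset.sum_congr rfl fun j _ => ?_
    push_cast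
    ring
  · intro j hj
    have hz : ∀ t : ℝ, tbSpline Λ t * tbSpline Λ (t + j) = 0 := fun t => by
      by_contra hne
      have h1 := not_imp_comm.1 (tbSpline_eq_zero Λ t) (left_ne_zero_of_mul hne)
      have h2 := not_imp_comm.1 (tbSpline_eq_zero Λ (t + j)) (right_ne_zero_of_mul hne)
      refine hj (Finset.mem_Icc.2 ⟨?_, ?_⟩)
      · have : ((-(Λ.length : ℤ) : ℤ) : ℝ) ≤ j := by push_cast; linarith [h1.2, h2.1]
        exact_mod_cast this
      · have : (j : ℝ) ≤ (Λ.length : ℤ) := by push_cast; linarith [h1.1, h2.2]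
        exact_mod_cast this
    simp [hz]

theorem dualConst_ne_zero (Λ : List ℝ) : (dualConst Λ : ℂ) ≠ 0 :=
  Complex.ofReal_ne_zero.2 (Real.exp_pos _).ne'

theorem dualDenom_ne_zero {Λ : List ℝ} (hΛ : Λ ≠ []) (ξ : ℝ) : dualDenom Λ ξ ≠ 0 := by
  rw [dualDenom_eq_sum hΛ]
  refine mul_ne_zero (pow_ne_zero 2 (dualConst_ne_zero Λ)) fun h => ?_
  -- The symbol depends only on ξ modulo 2π, while φ̂ may vanish at nonzero multiples of 2π; these
  -- are replaced by 0.
  obtain ⟨η, hη, hexp⟩ : ∃ η : ℝ, (-η = 0 ∨ Complex.exp (Complex.I * (-η : ℝ)) ≠ 1) ∧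
      Complex.exp (Complex.I * η) = Complex.exp (Complex.I * ξ) := by
    by_cases h1 : Complex.exp (Complex.I * ξ) = 1
    · exact ⟨0, by simp, by simp [h1]⟩
    · refine ⟨ξ, Or.inr fun h2 => h1 ?_, rfl⟩
      rw [Complex.ofReal_neg, mul_neg, Complex.exp_neg] at h2
      exact inv_eq_one.1 h2
  obtain ⟨B, -, hB⟩ := exists_abs_tbSpline_le Λ
  rw [← hexp] at h
  refine hatFT_tbSpline_ne_zero hΛ (-η) hη ?_
  refine Eq.trans ?_ (integral_exp_mul_eq_zero_of_autocorrelation (List.length_pos_iff.2 hΛ)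
    (integrable_tbSpline Λ) hB (tbSpline_eq_zero Λ) η h)
  refine integral_congr_ae (Eventually.of_forall fun t => ?_)
  simp

/-! ### Fourier series of periodic C² functions -/

/-- Integration by parts, with boundary terms cancelling by periodicity; two applications give the
quadratic decay of the coefficients. -/
theorem integral_exp_mul_deriv_of_periodic {h : ℝ → ℂ} (hd : Differentiable ℝ h)
    (hc : Continuous (deriv h)) (hp : h.Periodic (2 * Real.pi)) (n : ℤ) :
    ∫ x in (0 : ℝ)..2 * Real.pi, Complex.exp (-(Complex.I * n * x)) * deriv h x =
      Complex.I * n * ∫ x in (0 : ℝ)..2 * Real.pi, Complex.exp (-(Complex.I * n * x)) * h x := by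
  have hE : Continuous fun x : ℝ => Complex.exp (-(Complex.I * n * x)) := by fun_prop
  have hder : ∀ x : ℝ, HasDerivAt (fun x : ℝ => Complex.exp (-(Complex.I * n * x)) * h x)
      (Complex.exp (-(Complex.I * n * x)) * deriv h x -
        Complex.I * n * (Complex.exp (-(Complex.I * n * x)) * h x)) x := fun x => by
    have h1 : HasDerivAt (fun x : ℝ => Complex.exp (-(Complex.I * n * x)))
        (Complex.exp (-(Complex.I * n * x)) * (-(Complex.I * n))) x := by
      refine HasDerivAt.cexp ?_
      convert! ((Complex.ofRealCLM.hasDerivAt (x := x)).const_mul (Complex.I * n)).neg using 1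
      simp
    convert! h1.mul (hd x).hasDerivAt using 1
    ring
  have i1 : IntervalIntegrable (fun x : ℝ => Complex.exp (-(Complex.I * n * x)) * deriv h x)
      volume 0 (2 * Real.pi) := (hE.mul hc).intervalIntegrable _ _
  have i2 : IntervalIntegrable
      (fun x : ℝ => Complex.I * n * (Complex.exp (-(Complex.I * n * x)) * h x))
      volume 0 (2 * Real.pi) := (continuous_const.mul (hE.mul hd.continuous)).intervalIntegrable _ _
  have hft := intervalIntegral.integral_eq_sub_of_hasDerivAt (fun x _ => hder x) (i1.sub i2)
  have hexp : Complex.exp (-(Complex.I * n * ((2 * Real.pi : ℝ) : ℂ))) = 1 := by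
    rw [← Complex.exp_int_mul_two_pi_mul_I (-n)]
    congr 1
    push_cast
    ring
  rw [intervalIntegral.integral_sub i1 i2, intervalIntegral.integral_const_mul, hexp,
    show h (2 * Real.pi) = h 0 by simpa using hp 0] at hft
  simpa [sub_eq_zero] using hft

/-- A `2π`-periodic `C²` function is the sum of its Fourier series, whose coefficients are
`O(1 / (1 + j²))`. -/
theorem exists_hasSum_exp_of_periodic {h : ℝ → ℂ} (hh : ContDiff ℝ 2 h)
    (hp : h.Periodic (2 * Real.pi)) :
    ∃ (c : ℤ → ℂ) (C : ℝ), (∀ j, ‖c j‖ * (1 + (j : ℝ) ^ 2) ≤ C) ∧ (Summable fun j => ‖c j‖) ∧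
      ∀ ξ : ℝ, HasSum (fun j => c j * Complex.exp (Complex.I * j * ξ)) (h ξ) := by
  have hT : Fact (0 < 2 * Real.pi) := ⟨Real.two_pi_pos⟩
  have hd0 : Differentiable ℝ h := hh.differentiable (by norm_num)
  have hh1 : ContDiff ℝ 1 (deriv h) := (contDiff_succ_iff_deriv (n := 1).1 (by exact hh)).2.2
  have hd1 : Differentiable ℝ (deriv h) := hh1.differentiable (by norm_num)
  have hc2 : Continuous (deriv (deriv h)) := hh1.continuous_deriv le_rfl
  have hp1 : (deriv h).Periodic (2 * Real.pi) := fun x => by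
    rw [← deriv_comp_add_const]
    congr 1
    funext y
    exact hp y
  set J : (ℝ → ℂ) → ℤ → ℂ := fun g n =>
    ∫ x in (0 : ℝ)..2 * Real.pi, Complex.exp (-(Complex.I * n * x)) * g x with hJ
  have hJb : ∀ g n, ‖J g n‖ ≤ ∫ x in (0 : ℝ)..2 * Real.pi, ‖g x‖ := fun g n => by
    refine (intervalIntegral.norm_integral_le_integral_norm Real.two_pi_pos.le).trans_eq ?_
    refine intervalIntegral.integral_congr fun x _ => ?_
    have e : -(Complex.I * n * x) = ((-(n * x) : ℝ) : ℂ) * Complex.I := by push_cast; ring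
    simp only [norm_mul]
    rw [e, Complex.norm_exp_ofReal_mul_I, one_mul]
  have hJ2 : ∀ n : ℤ, ‖J h n‖ * (1 + (n : ℝ) ^ 2) = ‖J h n‖ + ‖J (deriv (deriv h)) n‖ := fun n => by
    have e : J (deriv (deriv h)) n = Complex.I * n * (Complex.I * n * J h n) := by
      simp only [hJ]
      rw [integral_exp_mul_deriv_of_periodic hd1 hc2 hp1,
        integral_exp_mul_deriv_of_periodic hd0 hd1.continuous hp]
    have en : ‖(n : ℂ)‖ = |(n : ℝ)| := by simp
    rw [e, norm_mul, norm_mul, norm_mul, norm_mul, Complex.norm_I, en, ← sq_abs (n : ℝ)]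
    ring
  set F : C(AddCircle (2 * Real.pi), ℂ) :=
    ⟨hp.lift, continuous_coinduced_dom.mpr hd0.continuous⟩ with hF
  have hcoef : ∀ n, fourierCoeff F n = (1 / (2 * Real.pi)) • J h n := fun n => by
    rw [fourierCoeff_eq_intervalIntegral _ _ 0, zero_add]
    congr 1
    refine intervalIntegral.integral_congr fun x _ => ?_
    have hFx : F (x : AddCircle (2 * Real.pi)) = h x := hp.lift_coe x
    simp only [hFx, fourier_coe_apply, smul_eq_mul]
    congr 2
    have hpi : (Real.pi : ℂ) ≠ 0 := by exact_mod_cast Real.pi_ne_zero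
    push_cast
    field_simp
  have hcoefn : ∀ n, ‖fourierCoeff F n‖ = 1 / (2 * Real.pi) * ‖J h n‖ := fun n => by
    rw [hcoef, norm_smul, Real.norm_of_nonneg (by positivity)]
  obtain ⟨C, hC⟩ : ∃ C, ∀ j : ℤ, ‖fourierCoeff F j‖ * (1 + (j : ℝ) ^ 2) ≤ C := by
    refine ⟨1 / (2 * Real.pi) * ((∫ x in (0 : ℝ)..2 * Real.pi, ‖h x‖) +
      ∫ x in (0 : ℝ)..2 * Real.pi, ‖deriv (deriv h) x‖), fun j => ?_⟩
    rw [hcoefn, mul_assoc, hJ2]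
    exact mul_le_mul_of_nonneg_left (add_le_add (hJb _ _) (hJb _ _)) (by positivity)
  have hsum : Summable fun j => ‖fourierCoeff F j‖ := by
    refine Summable.of_norm_bounded_eventually
      ((Real.summable_one_div_int_pow.2 one_lt_two).mul_left C) ?_
    -- At `j = 0` the majorant `C * (1 / j ^ 2)` has the junk value 0.
    filter_upwards [(finite_singleton (0 : ℤ)).compl_mem_cofinite] with j hj
    have hj' : (0 : ℝ) < (j : ℝ) ^ 2 := by
      have : (j : ℝ) ≠ 0 := by exact_mod_cast hj
      positivity
    rw [norm_norm, mul_one_div, le_div_iff₀ hj']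
    exact le_trans (mul_le_mul_of_nonneg_left (by linarith) (norm_nonneg _)) (hC j)
  refine ⟨fourierCoeff F, C, hC, hsum, fun ξ => ?_⟩
  have hs := has_pointwise_sum_fourier_series_of_summable hsum.of_norm (ξ : AddCircle (2 * Real.pi))
  have hFx : F (ξ : AddCircle (2 * Real.pi)) = h ξ := hp.lift_coe ξ
  rw [hFx] at hs
  convert! hs using 2 with j
  rw [smul_eq_mul, fourier_coe_apply]
  congr 2
  have hpi : (Real.pi : ℂ) ≠ 0 := by exact_mod_cast Real.pi_ne_zero
  push_cast
  field_simp

/-! ### The dual function as a series of translates -/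

/-- The superposition `∑ j, c j * φ(t + j)` of the integer translates of `φ = Q_N[Λ]`. -/
noncomputable def translateSeries (Λ : List ℝ) (c : ℤ → ℂ) (t : ℝ) : ℂ :=
  ∑' j : ℤ, c j * (tbSpline Λ (t + j) : ℂ)

theorem summable_translateSeries (Λ : List ℝ) {c : ℤ → ℂ} (hc : Summable fun j => ‖c j‖) (t : ℝ) :
    Summable fun j : ℤ => c j * (tbSpline Λ (t + j) : ℂ) := by
  obtain ⟨B, -, hB⟩ := exists_abs_tbSpline_le Λ
  refine Summable.of_norm_bounded (hc.mul_right B) fun j => ?_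
  rw [norm_mul, Complex.norm_real]
  exact mul_le_mul_of_nonneg_left (hB _) (norm_nonneg _)

theorem rightCont_translateSeries (Λ : List ℝ) {c : ℤ → ℂ} (hc : Summable fun j => ‖c j‖) (t : ℝ) :
    ContinuousWithinAt (translateSeries Λ c) (Ici t) t := by
  obtain ⟨B, -, hB⟩ := exists_abs_tbSpline_le Λ
  refine tendsto_tsum_of_dominated_convergence (hc.mul_right B) (fun j => ?_)
    (Eventually.of_forall fun s j => ?_)
  · have hmaps : MapsTo (fun s : ℝ => s + j) (Ici t) (Ici (t + j)) :=
      fun s hs => by simpa using hs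
    have h1 : ContinuousWithinAt (fun s : ℝ => tbSpline Λ (s + j)) (Ici t) t :=
      ContinuousWithinAt.comp (f := fun s : ℝ => s + j) (rightCont_tbSpline Λ (t + j))
        (by fun_prop) hmaps
    exact ((Complex.continuous_ofReal.tendsto _).comp h1).const_mul (c j)
  · rw [norm_mul, Complex.norm_real]
    exact mul_le_mul_of_nonneg_left (hB _) (norm_nonneg _)

/-- Only the at most N + 1 indices with 0 ≤ t + j ≤ N contribute, and for these the weight 1 + t² is
controlled by 1 + j², which the coefficients absorb. -/
theorem exists_norm_translateSeries_mul_le (Λ : List ℝ) {c : ℤ → ℂ} {C : ℝ}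
    (hC : ∀ j, ‖c j‖ * (1 + (j : ℝ) ^ 2) ≤ C) :
    ∃ M, ∀ t, ‖translateSeries Λ c t‖ * (1 + t ^ 2) ≤ M := by
  obtain ⟨B, hB0, hB⟩ := exists_abs_tbSpline_le Λ
  set N := Λ.length with hN
  have hC0 : 0 ≤ C := le_trans (by positivity) (hC 0)
  refine ⟨(N + 1) * (2 * (1 + (N : ℝ) ^ 2) * C * B), fun t => ?_⟩
  have hfin : translateSeries Λ c t =
      ∑ j ∈ Finset.Icc ⌈-t⌉ ⌊(N : ℝ) - t⌋, c j * (tbSpline Λ (t + j) : ℂ) := by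
    refine tsum_eq_sum fun j hj => ?_
    rw [tbSpline_eq_zero, Complex.ofReal_zero, mul_zero]
    refine fun hm => hj (Finset.mem_Icc.2 ⟨Int.ceil_le.2 ?_, Int.le_floor.2 ?_⟩)
    · linarith [hm.1]
    · linarith [hm.2]
  have hterm : ∀ j ∈ Finset.Icc ⌈-t⌉ ⌊(N : ℝ) - t⌋,
      ‖c j * (tbSpline Λ (t + j) : ℂ)‖ * (1 + t ^ 2) ≤ 2 * (1 + (N : ℝ) ^ 2) * C * B := by
    intro j hj
    obtain ⟨h1, h2⟩ := Finset.mem_Icc.1 hj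
    rw [Int.ceil_le] at h1
    rw [Int.le_floor] at h2
    have ht : 1 + t ^ 2 ≤ 2 * (1 + (N : ℝ) ^ 2) * (1 + (j : ℝ) ^ 2) := by
      have h3 : (t + j) ^ 2 ≤ (N : ℝ) ^ 2 :=
        pow_le_pow_left₀ (by linarith) (by linarith) 2
      have h4 : 0 ≤ (N : ℝ) ^ 2 * (j : ℝ) ^ 2 := by positivity
      -- This square is 2(t+j)² + 2j² - t².
      nlinarith [sq_nonneg (t + 2 * j)]
    rw [norm_mul, Complex.norm_real]
    calc ‖c j‖ * ‖tbSpline Λ (t + j)‖ * (1 + t ^ 2)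
        ≤ ‖c j‖ * B * (2 * (1 + (N : ℝ) ^ 2) * (1 + (j : ℝ) ^ 2)) :=
          mul_le_mul (mul_le_mul_of_nonneg_left (hB _) (norm_nonneg _)) ht (by positivity)
            (by positivity)
      _ = 2 * (1 + (N : ℝ) ^ 2) * (‖c j‖ * (1 + (j : ℝ) ^ 2)) * B := by ring
      _ ≤ 2 * (1 + (N : ℝ) ^ 2) * C * B := by gcongr; exact hC j
  have hcard : ((Finset.Icc ⌈-t⌉ ⌊(N : ℝ) - t⌋).card : ℝ) ≤ N + 1 := by
    have h1 : ⌊(N : ℝ) - t⌋ + 1 - ⌈-t⌉ ≤ (N : ℤ) + 1 := by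
      have : ((⌊(N : ℝ) - t⌋ + 1 - ⌈-t⌉ : ℤ) : ℝ) ≤ ((N + 1 : ℤ) : ℝ) := by
        push_cast
        linarith [Int.floor_le ((N : ℝ) - t), Int.le_ceil (-t)]
      exact_mod_cast this
    rw [Int.card_Icc]
    have h2 : (⌊(N : ℝ) - t⌋ + 1 - ⌈-t⌉).toNat ≤ N + 1 := by omega
    exact_mod_cast h2
  rw [hfin]
  calc ‖∑ j ∈ Finset.Icc ⌈-t⌉ ⌊(N : ℝ) - t⌋, c j * (tbSpline Λ (t + j) : ℂ)‖ * (1 + t ^ 2)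
      ≤ (∑ j ∈ Finset.Icc ⌈-t⌉ ⌊(N : ℝ) - t⌋, ‖c j * (tbSpline Λ (t + j) : ℂ)‖) * (1 + t ^ 2) :=
        mul_le_mul_of_nonneg_right (norm_sum_le _ _) (by positivity)
    _ = ∑ j ∈ Finset.Icc ⌈-t⌉ ⌊(N : ℝ) - t⌋,
        ‖c j * (tbSpline Λ (t + j) : ℂ)‖ * (1 + t ^ 2) := Finset.sum_mul _ _ _
    _ ≤ (Finset.Icc ⌈-t⌉ ⌊(N : ℝ) - t⌋).card • (2 * (1 + (N : ℝ) ^ 2) * C * B) :=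
        Finset.sum_le_card_nsmul _ _ _ hterm
    _ ≤ (N + 1) * (2 * (1 + (N : ℝ) ^ 2) * C * B) := by
        rw [nsmul_eq_mul]
        exact mul_le_mul_of_nonneg_right hcard (by positivity)

theorem aestronglyMeasurable_translateSeries (Λ : List ℝ) {c : ℤ → ℂ}
    (hc : Summable fun j => ‖c j‖) : AEStronglyMeasurable (translateSeries Λ c) volume := by
  refine aestronglyMeasurable_of_tendsto_ae (u := (atTop : Filter (Finset ℤ)))
    (f := fun s t => ∑ j ∈ s, c j * (tbSpline Λ (t + j) : ℂ)) (fun s => ?_)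
    (Eventually.of_forall fun t => (summable_translateSeries Λ hc t).hasSum)
  exact (integrable_finsetSum s fun j _ =>
    ((integrable_tbSpline Λ).comp_add_right (j : ℝ)).ofReal.const_mul (c j)).1

theorem integrable_of_norm_mul_le {f : ℝ → ℂ} (hf : AEStronglyMeasurable f volume) {M : ℝ}
    (hM : ∀ t, ‖f t‖ * (1 + t ^ 2) ≤ M) : Integrable f := by
  refine (integrable_inv_one_add_sq.const_mul M).mono' hf (Eventually.of_forall fun t => ?_)
  rw [← div_eq_mul_inv, le_div_iff₀ (by positivity)]
  exact hM t

theorem memLp_two_of_norm_mul_le {f : ℝ → ℂ} (hf : AEStronglyMeasurable f volume) {M : ℝ}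
    (hM : ∀ t, ‖f t‖ * (1 + t ^ 2) ≤ M) : MemLp f 2 (volume : Measure ℝ) := by
  rw [memLp_two_iff_integrable_sq_norm hf]
  have hi := (integrable_of_norm_mul_le hf hM).norm
  have hb : ∀ t, ‖f t‖ ≤ M := fun t => by
    refine le_trans (le_mul_of_one_le_right (norm_nonneg _) ?_) (hM t)
    linarith [sq_nonneg t]
  simp only [sq]
  exact hi.bdd_mul hf.norm (Eventually.of_forall fun t => by rw [norm_norm]; exact hb t)

theorem norm_exp_neg_I_mul (ξ t : ℝ) : ‖Complex.exp (-(Complex.I * ξ * t))‖ = 1 := by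
  have e : -(Complex.I * ξ * t) = ((-(ξ * t) : ℝ) : ℂ) * Complex.I := by push_cast; ring
  rw [e, Complex.norm_exp_ofReal_mul_I]

theorem hatFT_comp_add_right (f : ℝ → ℂ) (ξ s : ℝ) :
    hatFT (fun t => f (t + s)) ξ = Complex.exp (Complex.I * s * ξ) * hatFT f ξ := by
  have h := integral_add_right_eq_self (μ := (volume : Measure ℝ))
    (fun t : ℝ => Complex.exp (Complex.I * s * ξ) * (Complex.exp (-(Complex.I * ξ * t)) * f t)) s
  rw [hatFT, hatFT, ← integral_const_mul, ← h]
  refine integral_congr_ae (Eventually.of_forall fun t => ?_)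
  simp only
  rw [← mul_assoc, ← Complex.exp_add]
  congr 2
  push_cast
  ring

/-- Each translate contributes a factor e^{ijξ}; sum and integral may be exchanged because ∑ ‖c j‖
‖φ‖₁ is finite. -/
theorem hatFT_translateSeries (Λ : List ℝ) {c : ℤ → ℂ} (hc : Summable fun j => ‖c j‖) {ξ : ℝ}
    {w : ℂ} (hw : HasSum (fun j : ℤ => c j * Complex.exp (Complex.I * j * ξ)) w) :
    hatFT (translateSeries Λ c) ξ = hatFT (fun t => (tbSpline Λ t : ℂ)) ξ * w := by
  set F : ℤ → ℝ → ℂ := fun j t =>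
    Complex.exp (-(Complex.I * ξ * t)) * (c j * (tbSpline Λ (t + j) : ℂ)) with hF
  have hE : Continuous fun t : ℝ => Complex.exp (-(Complex.I * ξ * t)) := by fun_prop
  have hFi : ∀ j, Integrable (F j) := fun j =>
    (((integrable_tbSpline Λ).comp_add_right (j : ℝ)).ofReal.const_mul (c j)).bdd_mul
      hE.aestronglyMeasurable (Eventually.of_forall fun t => (norm_exp_neg_I_mul ξ t).le)
  have hFn : ∀ j, ∫ t, ‖F j t‖ = ‖c j‖ * ∫ t, ‖tbSpline Λ t‖ := fun j => by
    rw [← integral_add_right_eq_self (fun t => ‖tbSpline Λ t‖) (j : ℝ), ← integral_const_mul]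
    refine integral_congr_ae (Eventually.of_forall fun t => ?_)
    simp only [hF, norm_mul, norm_exp_neg_I_mul, one_mul, Complex.norm_real]
  have hs := hasSum_integral_of_summable_integral_norm hFi
    (by simp only [hFn]; exact hc.mul_right _)
  have hFt : ∀ j, ∫ t, F j t =
      hatFT (fun t => (tbSpline Λ t : ℂ)) ξ * (c j * Complex.exp (Complex.I * j * ξ)) := fun j => by
    have h := hatFT_comp_add_right (fun t => (tbSpline Λ t : ℂ)) ξ j
    rw [Complex.ofReal_intCast] at h
    rw [mul_left_comm, mul_comm (hatFT _ ξ), ← h, hatFT, ← integral_const_mul]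
    refine integral_congr_ae (Eventually.of_forall fun t => ?_)
    simp only [hF]
    ring
  simp only [hFt] at hs
  rw [(hw.mul_left (hatFT (fun t => (tbSpline Λ t : ℂ)) ξ)).unique hs, hatFT]
  refine integral_congr_ae (Eventually.of_forall fun t => ?_)
  simp only [hF, translateSeries, tsum_mul_left]

theorem contDiff_dualDenom {Λ : List ℝ} (hΛ : Λ ≠ []) : ContDiff ℝ 2 (dualDenom Λ) := by
  have he : ∀ j : ℤ, ContDiff ℝ 2 fun ξ : ℝ => Complex.exp (Complex.I * ξ) ^ j := fun j => by
    have e : (fun ξ : ℝ => Complex.exp (Complex.I * ξ) ^ j) =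
        fun ξ : ℝ => Complex.exp (j * (Complex.I * Complex.ofRealCLM ξ)) := by
      funext ξ
      rw [Complex.exp_int_mul]
      rfl
    rw [e]
    fun_prop
  rw [funext (dualDenom_eq_sum hΛ)]
  exact contDiff_const.mul (ContDiff.sum fun j _ => (he j).mul contDiff_const)

theorem periodic_dualDenom (Λ : List ℝ) : (dualDenom Λ).Periodic (2 * Real.pi) := fun ξ => by
  have e : Complex.exp (Complex.I * ((ξ + 2 * Real.pi : ℝ) : ℂ)) = Complex.exp (Complex.I * ξ) := by
    rw [← Complex.exp_periodic (Complex.I * ξ)]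
    congr 1
    push_cast
    ring
  rw [dualDenom, dualDenom, e]

/-- The coefficients are the Fourier coefficients of C_S² / denominator, which is C² because the
denominator has no zeros. -/
theorem exists_isDualFunction {Λ : List ℝ} (hΛ : Λ ≠ []) :
    ∃ ψ, IsDualFunction Λ ψ ∧ ∃ M, ∀ t, ‖ψ t‖ * (1 + t ^ 2) ≤ M := by
  have hcd : ContDiff ℝ 2 fun ξ => (dualConst Λ : ℂ) ^ 2 * (dualDenom Λ ξ)⁻¹ :=
    contDiff_const.mul ((contDiff_dualDenom hΛ).inv (dualDenom_ne_zero hΛ))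
  obtain ⟨c, C, hC, hc, hs⟩ := exists_hasSum_exp_of_periodic hcd fun ξ => by
    simp only [periodic_dualDenom Λ ξ]
  obtain ⟨M, hM⟩ := exists_norm_translateSeries_mul_le Λ hC
  have hm := aestronglyMeasurable_translateSeries Λ hc
  refine ⟨translateSeries Λ c, ⟨HasL2Hat.of_integrable (integrable_of_norm_mul_le hm hM)
    (memLp_two_of_norm_mul_le hm hM) fun ξ => ?_, rightCont_translateSeries Λ hc⟩, M, hM⟩
  rw [hatFT_translateSeries Λ hc (hs ξ), dualHat]
  ring

/-! ### Decay and the main theorem -/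

theorem decaysWith_one_of_norm_mul_le {E : Type*} [NormedAddCommGroup E] {f : ℝ → E} {M : ℝ}
    (hM : ∀ t, ‖f t‖ * (1 + t ^ 2) ≤ M) : DecaysWith 1 f := by
  refine IsBigO.of_bound M ?_
  have hne : ∀ᶠ t : ℝ in atBot ⊔ atTop, t ≠ 0 :=
    eventually_sup.2 ⟨eventually_ne_atBot 0, eventually_ne_atTop 0⟩
  filter_upwards [hne] with t ht
  have ht2 : 0 < t ^ 2 := by positivity
  have e : |t| ^ (-1 - 1 : ℝ) = (t ^ 2)⁻¹ := by
    rw [show (-1 - 1 : ℝ) = -(2 : ℕ) by norm_num, Real.rpow_neg (abs_nonneg t),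
      Real.rpow_natCast, sq_abs]
  rw [e, Real.norm_of_nonneg (by positivity), ← div_eq_mul_inv, le_div_iff₀ ht2]
  exact le_trans (mul_le_mul_of_nonneg_left (by linarith) (norm_nonneg _)) (hM t)

theorem exists_norm_tbSpline_mul_le (Λ : List ℝ) : ∃ M, ∀ t, ‖tbSpline Λ t‖ * (1 + t ^ 2) ≤ M := by
  obtain ⟨B, hB0, hB⟩ := exists_abs_tbSpline_le Λ
  refine ⟨B * (1 + (Λ.length : ℝ) ^ 2), fun t => ?_⟩
  by_cases ht : t ∈ Icc (0 : ℝ) Λ.length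
  · exact mul_le_mul (hB t) (by gcongr; exacts [ht.1, ht.2]) (by positivity) hB0
  · rw [tbSpline_eq_zero Λ t ht, norm_zero, zero_mul]
    positivity

theorem mainTheorem10 (N : ℕ) (hN : 1 ≤ N) (Λ : List ℝ) (hΛ : Λ.length = N) :
    (∀ ξ : ℝ, dualDenom Λ ξ ≠ 0) ∧
    (∃! φdual : ℝ → ℂ, IsDualFunction Λ φdual) ∧
    ∀ φdual : ℝ → ℂ, IsDualFunction Λ φdual →
      (∃ ε : ℝ, 0 < ε ∧ DecaysWith ε (tbSpline Λ) ∧ DecaysWith ε φdual) ∧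
      ∃ C : ℝ, ∀ t : ℝ, ‖φdual t * (1 + (t : ℂ) ^ 2)‖ ≤ C := by
  have hne : Λ ≠ [] := List.length_pos_iff.1 (by omega)
  obtain ⟨ψ, hψ, M, hM⟩ := exists_isDualFunction hne
  obtain ⟨M', hM'⟩ := exists_norm_tbSpline_mul_le Λ
  refine ⟨dualDenom_ne_zero hne, ⟨ψ, hψ, fun χ hχ => hχ.unique hψ⟩, fun χ hχ => ?_⟩
  -- By uniqueness every dual function is the constructed one; its quadratic decay gives ε = 1.
  rw [hχ.unique hψ]
  refine ⟨⟨1, one_pos, decaysWith_one_of_norm_mul_le hM', decaysWith_one_of_norm_mul_le hM⟩,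
    M, fun t => ?_⟩
  have e : (1 + (t : ℂ) ^ 2) = ((1 + t ^ 2 : ℝ) : ℂ) := by push_cast; ring
  rw [e, norm_mul, Complex.norm_real, Real.norm_of_nonneg (by positivity)]
  exact hM t
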